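/- Let $\mathbf{k}$ be a field of characteristic $0$, let $V$ be a $\mathbf{k}$-vector space with basis $w_1,\dots,w_k$, $k\ge 3$, and let $q_{ij}\in\mathbf{k}^\times$ with $q_{ii}=1$ and $q_{ji}=q_{ij}^{-1}$. Let $S_{\mathbf q}(V)=T(V)/(w_iw_j-q_{ij}w_jw_i)$. Let $G$ be a finite group acting linearly on $V$, diagonally with respect to $w_1,\dots,w_k$; extend the action to $S_{\mathbf q}(V)$ by algebra automorphisms, and let $A=S_{\mathbf q}(V)\#G$ be the smash product, with $(a\#g)(b\#h)=a\,g(b)\#gh$. Let $q\in\mathbf{k}^\times$ and let $H_q$ be the bialgebra over $\mathbf{k}$ generated by $D_1,D_2,\sigma,\sigma^{-1}$ with relations $D_1D_2=D_2D_1$, $q\sigma D_i=D_i\sigma$ $(i=1,2)$, $\sigma\sigma^{-1}=\sigma^{-1}\sigma=1$ and, if $q$ is a primitive $n$th root of unity with $n\ge2$, also $D_1^n=D_2^n=0$; its coproduct and counit are given by $\Delta(D_1)=D_1\otimes\sigma+1\otimes D_1$, $\Delta(D_2)=D_2\otimes1+\sigma\otimes D_2$, $\Delta(\sigma)=\sigma\otimes\sigma$,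 $\varepsilon(D_1)=\varepsilon(D_2)=0$, $\varepsilon(\sigma)=1$. Put $$\exp_q(tD_1\otimes D_2)=\sum_i \frac{1}{(i)_q!}\,(tD_1\otimes D_2)^i\in(H_q\otimes H_q)[[t]],$$ where the sum is over $0\le i<n$ if $q$ is a primitive $n$th root of unity with $n\ge 2$, and over all $i\ge0$ otherwise; here $(i)_q=1+q+\dots+q^{i-1}$ and $(i)_q!=(1)_q\cdots(i)_q$. Let $\lambda_1,\dots,\lambda_k\in\mathbf{k}^\times$, let $\xi:G\to\mathbf{k}^\times$ be a group homomorphism, let $g_1,g_2\in G$, and let $P_1,P_2$ be nonzero elements of the subalgebra of $S_{\mathbf q}(V)$ generated by $w_3,\dots,w_k$, such that for $i=1,2$ and every $j\ne i$ there is a scalar $q_{P_i,w_j}\in\mathbf{k}$ with $P_iw_j=q_{P_i,w_j}w_jP_i$. Suppose that $A$ is an $H_q$-module algebra (that is, an $H_q$-module with $h(ab)=\sum h_1(a)h_2(b)$ and $h(1)=\varepsilon(h)1$) in which $$\sigma(w_i)=\lambda_iw_i,\quad \sigma(g)=\xi(g)g,\quad D_1(w_1)=P_1g_1,\quad D_1(w_i)=0\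 (i\neq1),\quad D_2(w_2)=P_2g_2,\quad D_2(w_i)=0\ (i\ne2),\quad D_1(g)=D_2(g)=0$$ for all $i$ and all $g\in G$. Then the product $m\circ\exp_q(tD_1\otimes D_2)$, extended $\mathbf{k}[[t]]$-bilinearly to $A[[t]]$, where $m$ is the multiplication of $A$, is a formal deformation of $A$: it is associative with a unit, and it has the form $a*b=ab+\mu_1(a\otimes b)t+\mu_2(a\otimes b)t^2+\cdots$ for $a,b\in A$. Its infinitesimal is $\mu_1=m\circ(D_1\otimes D_2)$; this is a Hochschild $2$-cocycle, and its class in $\mathrm{HH}^2(A)=\mathrm{HH}^2(A,A)$ is nonzero. The deformation is nontrivial: $A[[t]]$ with the product $*$ is not isomorphic, as a $\mathbf{k}[[t]]$-algebra, to $A[[t]]$ with the usual product of power series. -/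

import Mathlib

open scoped TensorProduct

noncomputable section

namespace QuantumSmash

/-! ### Formal deformations and Hochschild cohomology of an algebra -/

section Deformations

variable {k A : Type*} [Field k] [Ring A] [Algebra k A]

/-- The `k⟦t⟧`-bilinear product on `A⟦t⟧` which is given on `A` by
`a * b = μ₀ (a ⊗ b) + μ₁ (a ⊗ b) t + μ₂ (a ⊗ b) t ^ 2 + ⋯`. -/
def starMul (μ : ℕ → A ⊗[k] A →ₗ[k] A) (f g : PowerSeries A) : PowerSeries A :=
  PowerSeries.mk fun n =>
    ∑ p ∈ Finset.HasAntidiagonal.antidiagonal n, ∑ s ∈ Finset.HasAntidiagonal.antidiagonal p.2,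
      μ p.1 (PowerSeries.coeff s.1 f ⊗ₜ[k] PowerSeries.coeff s.2 g)

/-- The sequence `μ` is a formal deformation of `A`: its zeroth term is the multiplication of `A`,
and the product on `A⟦t⟧` that it defines is associative and has a unit. -/
structure IsFormalDeformation (μ : ℕ → A ⊗[k] A →ₗ[k] A) : Prop where
  zero : μ 0 = LinearMap.mul' k A
  assoc : ∀ f g h, starMul μ (starMul μ f g) h = starMul μ f (starMul μ g h)
  unit : ∃ e, ∀ f, starMul μ e f = f ∧ starMul μ f e = f

/-- Triviality: `A⟦t⟧` with the deformed product is isomorphic, as an algebra over `k⟦t⟧`, to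
`A⟦t⟧` with the usual product of power series. (The scalar `c : k⟦t⟧` acts on `A⟦t⟧` as
multiplication by the central power series `PowerSeries.map (algebraMap k A) c`. No condition is
put on the isomorphism modulo `t`.) -/
def IsTrivialDeformation (μ : ℕ → A ⊗[k] A →ₗ[k] A) : Prop :=
  ∃ Φ : PowerSeries A ≃+ PowerSeries A,
    (∀ (c : PowerSeries k) (f : PowerSeries A),
      Φ (PowerSeries.map (algebraMap k A) c * f) =
        PowerSeries.map (algebraMap k A) c * Φ f) ∧
    ∀ f g, Φ (starMul μ f g) = Φ f * Φ g

/-- The cohomology `ker d₂ / im d₁` at the middle of a complex `M₁ → M₂ → M₃`. -/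
abbrev Cohomology {M₁ M₂ M₃ : Type*} [AddCommGroup M₁] [Module k M₁] [AddCommGroup M₂] [Module k M₂]
    [AddCommGroup M₃] [Module k M₃] (d₁ : M₁ →ₗ[k] M₂) (d₂ : M₂ →ₗ[k] M₃) : Type _ :=
  LinearMap.ker d₂ ⧸ (LinearMap.range d₁).comap (LinearMap.ker d₂).subtype

variable (k A)

/-- The Hochschild differential from `1`-cochains to `2`-cochains with values in `A`. -/
def hochschildD1 : (A →ₗ[k] A) →ₗ[k] (A ⊗[k] A →ₗ[k] A) where
  toFun f := LinearMap.mul' k A ∘ₗ f.lTensor A - f ∘ₗ LinearMap.mul' k A +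
    LinearMap.mul' k A ∘ₗ f.rTensor A
  map_add' f g := by
    ext a b
    simp
    abel
  map_smul' c f := by
    ext a b
    simp [smul_sub, smul_add]

/-- The Hochschild differential from `2`-cochains to `3`-cochains with values in `A`. -/
def hochschildD2 : (A ⊗[k] A →ₗ[k] A) →ₗ[k] ((A ⊗[k] A) ⊗[k] A →ₗ[k] A) where
  toFun φ := LinearMap.mul' k A ∘ₗ φ.lTensor A ∘ₗ (TensorProduct.assoc k A A A).toLinearMap -
    φ ∘ₗ (LinearMap.mul' k A).rTensor A +
    φ ∘ₗ (LinearMap.mul' k A).lTensor A ∘ₗ (TensorProduct.assoc k A A A).toLinearMap -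
    LinearMap.mul' k A ∘ₗ φ.rTensor A
  map_add' φ ψ := by
    ext a b c
    simp
    abel
  map_smul' r φ := by
    ext a b c
    simp [smul_sub, smul_add]

variable {k A}

theorem hochschildD1_apply (f : A →ₗ[k] A) (a b : A) :
    hochschildD1 k A f (a ⊗ₜ b) = a * f b - f (a * b) + f a * b := by
  simp [hochschildD1]

theorem hochschildD2_apply (φ : A ⊗[k] A →ₗ[k] A) (a b c : A) :
    hochschildD2 k A φ (a ⊗ₜ b ⊗ₜ c) =
      a * φ (b ⊗ₜ c) - φ ((a * b) ⊗ₜ c) + φ (a ⊗ₜ (b * c)) - φ (a ⊗ₜ b) * c := by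
  simp [hochschildD2]

theorem hochschildD2_comp_hochschildD1 (f : A →ₗ[k] A) :
    hochschildD2 k A (hochschildD1 k A f) = 0 := by
  ext a b c
  simp only [TensorProduct.AlgebraTensorModule.curry_apply, LinearMap.restrictScalars_self,
    TensorProduct.curry_apply, hochschildD2_apply, hochschildD1_apply, LinearMap.zero_apply,
    mul_add, mul_sub, add_mul, sub_mul, mul_assoc]
  abel

variable (k A)

/-- The second Hochschild cohomology `HH²(A) = HH²(A, A)`. -/
abbrev HH2 : Type _ := Cohomology (hochschildD1 k A) (hochschildD2 k A)

variable {k A}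

/-- The class in `HH²(A)` of a Hochschild `2`-cocycle. -/
def HH2.mk (φ : A ⊗[k] A →ₗ[k] A) (hφ : hochschildD2 k A φ = 0) : HH2 k A :=
  Submodule.Quotient.mk ⟨φ, hφ⟩

theorem HH2.mk_eq_zero (φ : A ⊗[k] A →ₗ[k] A) (hφ : hochschildD2 k A φ = 0) :
    HH2.mk φ hφ = 0 ↔ ∃ f : A →ₗ[k] A, hochschildD1 k A f = φ := by
  rw [HH2.mk, Submodule.Quotient.mk_eq_zero]
  rfl

end Deformations

/-! ### Module algebras over a bialgebra -/

section ModuleAlgebra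

variable {k B A : Type*} [Field k] [Ring B] [Algebra k B] [Ring A] [Algebra k A]
  [Module B A] [IsScalarTower k B A]

/-- The linear map `B ⊗ B → A`, `h₁ ⊗ h₂ ↦ (h₁ • a) * (h₂ • b)`, that is,
`F ↦ (m ∘ F) (a ⊗ b)`. -/
def applyPair (a b : A) : B ⊗[k] B →ₗ[k] A :=
  LinearMap.mul' k A ∘ₗ
    TensorProduct.map ((LinearMap.toSpanSingleton B A a).restrictScalars k)
      ((LinearMap.toSpanSingleton B A b).restrictScalars k)

theorem applyPair_tmul (a b : A) (x y : B) :
    applyPair (k := k) a b (x ⊗ₜ[k] y) = (x • a) * (y • b) := by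
  simp [applyPair]

/-- For `F ∈ (B ⊗ B)⟦t⟧`, the coefficients `m ∘ Fᵢ : A ⊗ A → A` of the product `m ∘ F`. -/
def twist (F : PowerSeries (B ⊗[k] B)) (i : ℕ) : A ⊗[k] A →ₗ[k] A :=
  TensorProduct.lift <| LinearMap.mk₂ k (fun a b => applyPair a b (PowerSeries.coeff i F))
    (by
      intro a a' b
      induction PowerSeries.coeff i F using TensorProduct.induction_on with
      | zero => simp
      | tmul x y => simp [applyPair_tmul, add_mul]
      | add x y hx hy => simp only [map_add, hx, hy]; abel)
    (by
      intro c a b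
      induction PowerSeries.coeff i F using TensorProduct.induction_on with
      | zero => simp
      | tmul x y => simp [applyPair_tmul, smul_algebra_smul_comm]
      | add x y hx hy => simp only [map_add, hx, hy, smul_add])
    (by
      intro a b b'
      induction PowerSeries.coeff i F using TensorProduct.induction_on with
      | zero => simp
      | tmul x y => simp [applyPair_tmul, mul_add]
      | add x y hx hy => simp only [map_add, hx, hy]; abel)
    (by
      intro c a b
      induction PowerSeries.coeff i F using TensorProduct.induction_on with
      | zero => simp
      | tmul x y => simp [applyPair_tmul, smul_algebra_smul_comm]
      | add x y hx hy => simp only [map_add, hx, hy, smul_add])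

theorem twist_tmul (F : PowerSeries (B ⊗[k] B)) (i : ℕ) (a b : A) :
    twist F i (a ⊗ₜ b) = applyPair a b (PowerSeries.coeff i F) := by
  simp [twist]

end ModuleAlgebra

/-- `A` is a `B`-module algebra: `h (a b) = ∑ h₁(a) h₂(b)` and `h (1) = ε(h) 1`. -/
class IsModuleAlgebra (k B A : Type*) [Field k] [Ring B] [Bialgebra k B] [Ring A] [Algebra k A]
    [Module B A] [IsScalarTower k B A] : Prop where
  smul_mul : ∀ (h : B) (a b : A), h • (a * b) = applyPair a b (Coalgebra.comul (R := k) h)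
  smul_one : ∀ h : B, h • (1 : A) = algebraMap k A (Coalgebra.counit (R := k) h)

/-! ### Quantum integers -/

section QuantumIntegers

variable {k : Type*} [Field k]

/-- `(i)_q = 1 + q + ⋯ + q ^ (i - 1)`. -/
def qInt (q : k) (i : ℕ) : k := ∑ j ∈ Finset.range i, q ^ j

/-- `(i)_q! = (1)_q (2)_q ⋯ (i)_q`. -/
def qFactorial (q : k) (i : ℕ) : k := ∏ j ∈ Finset.range i, qInt q (j + 1)

/-- Gaussian binomial coefficients. -/
def qChoose (q : k) : ℕ → ℕ → k
  | _, 0 => 1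
  | 0, _ + 1 => 0
  | m + 1, i + 1 => qChoose q m i + q ^ (i + 1) * qChoose q m (i + 1)

theorem qChoose_eq_zero (q : k) : ∀ m i, m < i → qChoose q m i = 0
  | _, 0, h => absurd h (by omega)
  | 0, _ + 1, _ => by simp [qChoose]
  | m + 1, i + 1, h => by
    rw [qChoose, qChoose_eq_zero q m i (by omega), qChoose_eq_zero q m (i + 1) (by omega)]; simp

theorem qChoose_self (q : k) : ∀ m, qChoose q m m = 1
  | 0 => by simp [qChoose]
  | m + 1 => by rw [qChoose, qChoose_self q m, qChoose_eq_zero q m (m + 1) (by omega)]; simp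

theorem qInt_add (q : k) (i j : ℕ) : qInt q (i + j) = qInt q i + q ^ i * qInt q j := by
  simp only [qInt, Finset.sum_range_add, Finset.mul_sum, pow_add]

theorem qFactorial_succ (q : k) (i : ℕ) :
    qFactorial q (i + 1) = qFactorial q i * qInt q (i + 1) := by
  simp [qFactorial, Finset.prod_range_succ]

theorem qChoose_mul (q : k) : ∀ m i j, i + j = m →
    qChoose q m i * (qFactorial q i * qFactorial q j) = qFactorial q m
  | m, 0, j, h => by
    obtain rfl : j = m := by omega
    simp [qChoose, qFactorial]
  | m, i + 1, 0, h => by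
    obtain rfl : i + 1 = m := by omega
    rw [qChoose_self]; simp [qFactorial]
  | 0, i + 1, j + 1, h => absurd h (by omega)
  | m + 1, i + 1, j + 1, h => by
    have h1 := qChoose_mul q m i (j + 1) (by omega)
    have h2 := qChoose_mul q m (i + 1) j (by omega)
    have h3 : qInt q (m + 1) = qInt q (i + 1) + q ^ (i + 1) * qInt q (j + 1) := by
      rw [← qInt_add]; congr 1; omega
    rw [qChoose, qFactorial_succ q m, h3]
    rw [mul_add]
    nth_rewrite 1 [← h1]
    rw [← h2, qFactorial_succ q i, qFactorial_succ q j]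
    ring

/-- The quantum binomial theorem. -/
theorem add_pow_of_qComm {R : Type*} [Ring R] [Algebra k R] (q : k) (x y : R)
    (h : y * x = q • (x * y)) (m : ℕ) :
    (x + y) ^ m = ∑ i ∈ Finset.range (m + 1), qChoose q m i • (x ^ i * y ^ (m - i)) := by
  have hy : ∀ i, y * x ^ i = q ^ i • (x ^ i * y) := by
    intro i
    induction i with
    | zero => simp
    | succ i ih =>
      rw [pow_succ x i, ← mul_assoc, ih, smul_mul_assoc, mul_assoc, h, mul_smul_comm, smul_smul,
        mul_assoc, pow_succ]
  induction m with
  | zero => simp [qChoose]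
  | succ m ih =>
    rw [pow_succ', ih, add_mul, Finset.sum_range_succ' _ (m + 1)]
    have e1 : x * ∑ i ∈ Finset.range (m + 1), qChoose q m i • (x ^ i * y ^ (m - i)) =
        ∑ i ∈ Finset.range (m + 1), qChoose q m i • (x ^ (i + 1) * y ^ (m - i)) := by
      rw [Finset.mul_sum]
      refine Finset.sum_congr rfl fun i _ => ?_
      rw [mul_smul_comm, ← mul_assoc, pow_succ']
    have e2 : y * ∑ i ∈ Finset.range (m + 1), qChoose q m i • (x ^ i * y ^ (m - i)) =
        ∑ i ∈ Finset.range (m + 1), (q ^ i * qChoose q m i) • (x ^ i * y ^ (m + 1 - i)) := by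
      rw [Finset.mul_sum]
      refine Finset.sum_congr rfl fun i hi => ?_
      have : m + 1 - i = (m - i) + 1 := by have := Finset.mem_range.1 hi; omega
      rw [mul_smul_comm, ← mul_assoc, hy, smul_mul_assoc, smul_smul, mul_assoc, ← pow_succ', this,
        mul_comm]
    have e3 : ∑ i ∈ Finset.range (m + 1), (q ^ i * qChoose q m i) • (x ^ i * y ^ (m + 1 - i)) =
        (∑ i ∈ Finset.range (m + 1),
          (q ^ (i + 1) * qChoose q m (i + 1)) • (x ^ (i + 1) * y ^ (m - i))) + y ^ (m + 1) := by
      have := Finset.sum_range_succ'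
        (fun i => (q ^ i * qChoose q m i) • (x ^ i * y ^ (m + 1 - i))) (m + 1)
      rw [Finset.sum_range_succ, qChoose_eq_zero q m (m + 1) (by omega)] at this
      simpa [qChoose] using this
    rw [e1, e2, e3, ← add_assoc, ← Finset.sum_add_distrib]
    congr 1
    · refine Finset.sum_congr rfl fun i _ => ?_
      rw [qChoose, add_smul, Nat.add_sub_add_right]
    · simp [qChoose]

theorem qInt_eq_zero {q : k} {n : ℕ} (hn : 2 ≤ n) (hq : IsPrimitiveRoot q n) : qInt q n = 0 :=
  hq.geom_sum_eq_zero (by omega)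

theorem qInt_ne_zero {q : k} {n j : ℕ} (hq : IsPrimitiveRoot q n) (h0 : 0 < j) (hj : j < n) :
    qInt q j ≠ 0 := by
  intro h
  have := geom_sum_mul q j
  rw [qInt] at h
  rw [h, zero_mul] at this
  exact hq.pow_ne_one_of_pos_of_lt h0.ne' hj (sub_eq_zero.1 this.symm)

theorem qFactorial_ne_zero {q : k} {n j : ℕ} (hq : IsPrimitiveRoot q n) (hj : j < n) :
    qFactorial q j ≠ 0 :=
  Finset.prod_ne_zero_iff.2 fun i hi =>
    qInt_ne_zero hq (by omega) (by have := Finset.mem_range.1 hi; omega)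

theorem add_pow_eq_zero_of_qComm {R : Type*} [Ring R] [Algebra k R] {q : k} {n : ℕ} (hn : 2 ≤ n)
    (hq : IsPrimitiveRoot q n) {x y : R} (h : y * x = q • (x * y)) (hx : x ^ n = 0)
    (hy : y ^ n = 0) : (x + y) ^ n = 0 := by
  rw [add_pow_of_qComm q x y h]
  refine Finset.sum_eq_zero fun i hi => ?_
  rcases Nat.eq_zero_or_pos i with rfl | hi0
  · simp [hy]
  rcases Nat.lt_or_ge i n with hin | hin
  · have hc := qChoose_mul q n i (n - i) (by omega)
    have hz : qFactorial q n = 0 := by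
      obtain ⟨m, rfl⟩ : ∃ m, n = m + 1 := ⟨n - 1, by omega⟩
      rw [qFactorial_succ, qInt_eq_zero hn hq, mul_zero]
    rw [hz] at hc
    have := (mul_eq_zero.1 hc).resolve_right
      (mul_ne_zero (qFactorial_ne_zero hq hin) (qFactorial_ne_zero hq (by omega)))
    rw [this, zero_smul]
  · obtain rfl : i = n := by have := Finset.mem_range.1 hi; omega
    simp [hx]

end QuantumIntegers

/-! ### The Hopf algebra `H_q` -/

/-- Names of the generators `D₁, D₂, σ, σ⁻¹`. -/
inductive HqGen
  | D1 | D2 | s | sInv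

section Hq

variable {k : Type*} [Field k]

/-- The defining relations of `H_q`; the relations `D₁ ^ n = D₂ ^ n = 0` are imposed only when `q`
is a primitive `n`th root of unity with `n ≥ 2`. -/
inductive HqRel (q : kˣ) : FreeAlgebra k HqGen → FreeAlgebra k HqGen → Prop
  | comm : HqRel q (FreeAlgebra.ι k .D1 * FreeAlgebra.ι k .D2)
      (FreeAlgebra.ι k .D2 * FreeAlgebra.ι k .D1)
  | s_D1 : HqRel q ((q : k) • (FreeAlgebra.ι k .s * FreeAlgebra.ι k .D1))
      (FreeAlgebra.ι k .D1 * FreeAlgebra.ι k .s)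
  | s_D2 : HqRel q ((q : k) • (FreeAlgebra.ι k .s * FreeAlgebra.ι k .D2))
      (FreeAlgebra.ι k .D2 * FreeAlgebra.ι k .s)
  | s_sInv : HqRel q (FreeAlgebra.ι k .s * FreeAlgebra.ι k .sInv) 1
  | sInv_s : HqRel q (FreeAlgebra.ι k .sInv * FreeAlgebra.ι k .s) 1
  | D1_pow (n : ℕ) : 2 ≤ n → IsPrimitiveRoot (q : k) n → HqRel q (FreeAlgebra.ι k .D1 ^ n) 0
  | D2_pow (n : ℕ) : 2 ≤ n → IsPrimitiveRoot (q : k) n → HqRel q (FreeAlgebra.ι k .D2 ^ n) 0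

/-- The algebra `H_q`. -/
def Hq (q : kˣ) : Type _ := RingQuot (HqRel q)

namespace Hq

variable (q : kˣ)

instance : Ring (Hq q) := inferInstanceAs (Ring (RingQuot (HqRel q)))

instance : Algebra k (Hq q) := inferInstanceAs (Algebra k (RingQuot (HqRel q)))

def mk : FreeAlgebra k HqGen →ₐ[k] Hq q := RingQuot.mkAlgHom k (HqRel q)

/-- The generators of `H_q`. -/
def gen (x : HqGen) : Hq q := mk q (FreeAlgebra.ι k x)

/-- The generator `D₁`. -/
abbrev D1 : Hq q := gen q .D1
/-- The generator `D₂`. -/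
abbrev D2 : Hq q := gen q .D2
/-- The generator `σ`. -/
abbrev s : Hq q := gen q .s
/-- The generator `σ⁻¹`. -/
abbrev sInv : Hq q := gen q .sInv

variable {q}

theorem mk_rel {x y : FreeAlgebra k HqGen} (h : HqRel q x y) : mk q x = mk q y :=
  RingQuot.mkAlgHom_rel k h

theorem comm : D1 q * D2 q = D2 q * D1 q := by
  simpa [gen] using mk_rel (q := q) .comm

theorem D1_s : D1 q * s q = (q : k) • (s q * D1 q) := by
  simpa [gen] using (mk_rel (q := q) .s_D1).symm

theorem D2_s : D2 q * s q = (q : k) • (s q * D2 q) := by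
  simpa [gen] using (mk_rel (q := q) .s_D2).symm

theorem s_sInv : s q * sInv q = 1 := by
  simpa [gen] using mk_rel (q := q) .s_sInv

theorem sInv_s : sInv q * s q = 1 := by
  simpa [gen] using mk_rel (q := q) .sInv_s

theorem D1_pow {n : ℕ} (hn : 2 ≤ n) (hq : IsPrimitiveRoot (q : k) n) : D1 q ^ n = 0 := by
  simpa [gen] using mk_rel (q := q) (.D1_pow n hn hq)

theorem D2_pow {n : ℕ} (hn : 2 ≤ n) (hq : IsPrimitiveRoot (q : k) n) : D2 q ^ n = 0 := by
  simpa [gen] using mk_rel (q := q) (.D2_pow n hn hq)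

variable (q) in
/-- Algebra maps out of `H_q` from images of the generators that satisfy the relations. -/
def lift {R : Type*} [Ring R] [Algebra k R] (f : HqGen → R)
    (h : ∀ ⦃x y⦄, HqRel q x y → FreeAlgebra.lift k f x = FreeAlgebra.lift k f y) :
    Hq q →ₐ[k] R :=
  RingQuot.liftAlgHom k ⟨FreeAlgebra.lift k f, h⟩

theorem lift_gen {R : Type*} [Ring R] [Algebra k R] (f : HqGen → R)
    (h : ∀ ⦃x y⦄, HqRel q x y → FreeAlgebra.lift k f x = FreeAlgebra.lift k f y) (x : HqGen) :
    lift q f h (gen q x) = f x := by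
  have := RingQuot.liftAlgHom_mkAlgHom_apply k (FreeAlgebra.lift k f) h (FreeAlgebra.ι k x)
  rw [FreeAlgebra.lift_ι_apply] at this
  exact this

theorem algHom_ext {R : Type*} [Semiring R] [Algebra k R] {f g : Hq q →ₐ[k] R}
    (h : ∀ x, f (gen q x) = g (gen q x)) : f = g := by
  refine RingQuot.ringQuot_ext' k f g (FreeAlgebra.hom_ext (funext fun x => ?_))
  exact h x

variable (q) in
/-- Values of the comultiplication on the generators. -/
def comulGen : HqGen → Hq q ⊗[k] Hq q
  | .D1 => D1 q ⊗ₜ s q + 1 ⊗ₜ D1 q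
  | .D2 => D2 q ⊗ₜ 1 + s q ⊗ₜ D2 q
  | .s => s q ⊗ₜ s q
  | .sInv => sInv q ⊗ₜ sInv q

theorem comulGen_D1_pow {n : ℕ} (hn : 2 ≤ n) (hq : IsPrimitiveRoot (q : k) n) :
    comulGen q .D1 ^ n = 0 := by
  refine add_pow_eq_zero_of_qComm hn hq ?_ ?_ ?_
  · simp [D1_s]
  · rw [Algebra.TensorProduct.tmul_pow, D1_pow hn hq, TensorProduct.zero_tmul]
  · rw [Algebra.TensorProduct.tmul_pow, D1_pow hn hq, TensorProduct.tmul_zero]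

theorem comulGen_D2_pow {n : ℕ} (hn : 2 ≤ n) (hq : IsPrimitiveRoot (q : k) n) :
    comulGen q .D2 ^ n = 0 := by
  rw [comulGen, add_comm]
  refine add_pow_eq_zero_of_qComm hn hq ?_ ?_ ?_
  · simp [D2_s, TensorProduct.smul_tmul']
  · rw [Algebra.TensorProduct.tmul_pow, D2_pow hn hq, TensorProduct.tmul_zero]
  · rw [Algebra.TensorProduct.tmul_pow, D2_pow hn hq, TensorProduct.zero_tmul]

variable (q) in
/-- The comultiplication: `Δ D₁ = D₁ ⊗ σ + 1 ⊗ D₁`, `Δ D₂ = D₂ ⊗ 1 + σ ⊗ D₂`, `Δ σ = σ ⊗ σ`. -/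
def comulHom : Hq q →ₐ[k] Hq q ⊗[k] Hq q :=
  lift q (comulGen q) (by
    intro x y h
    cases h with
    | comm =>
      simp only [map_mul, FreeAlgebra.lift_ι_apply, comulGen, mul_add, add_mul,
        Algebra.TensorProduct.tmul_mul_tmul, one_mul, mul_one, D1_s, D2_s, comm,
        TensorProduct.smul_tmul', TensorProduct.tmul_smul]
      abel
    | s_D1 =>
      simp only [map_mul, map_smul, FreeAlgebra.lift_ι_apply, comulGen, mul_add, add_mul,
        Algebra.TensorProduct.tmul_mul_tmul, one_mul, mul_one, D1_s,
        TensorProduct.smul_tmul', TensorProduct.tmul_smul, smul_add]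
    | s_D2 =>
      simp only [map_mul, map_smul, FreeAlgebra.lift_ι_apply, comulGen, mul_add, add_mul,
        Algebra.TensorProduct.tmul_mul_tmul, one_mul, mul_one, D2_s,
        TensorProduct.smul_tmul', TensorProduct.tmul_smul, smul_add]
    | s_sInv =>
      simp [comulGen, s_sInv, Algebra.TensorProduct.one_def]
    | sInv_s =>
      simp [comulGen, sInv_s, Algebra.TensorProduct.one_def]
    | D1_pow n hn hq =>
      rw [map_pow, FreeAlgebra.lift_ι_apply, comulGen_D1_pow hn hq, map_zero]
    | D2_pow n hn hq =>
      rw [map_pow, FreeAlgebra.lift_ι_apply, comulGen_D2_pow hn hq, map_zero])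

variable (q) in
/-- Values of the counit on the generators. -/
def counitGen : HqGen → k
  | .D1 => 0
  | .D2 => 0
  | .s => 1
  | .sInv => 1

variable (q) in
/-- The counit: `ε D₁ = ε D₂ = 0`, `ε σ = 1`. -/
def counitHom : Hq q →ₐ[k] k :=
  lift q counitGen (by
    intro x y h
    cases h with
    | D1_pow n hn hq =>
      rw [map_pow, FreeAlgebra.lift_ι_apply, map_zero]; exact zero_pow (by omega)
    | D2_pow n hn hq =>
      rw [map_pow, FreeAlgebra.lift_ι_apply, map_zero]; exact zero_pow (by omega)
    | _ => simp [counitGen])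

theorem comulHom_gen (x : HqGen) : comulHom q (gen q x) = comulGen q x := lift_gen _ _ x

theorem counitHom_gen (x : HqGen) : counitHom q (gen q x) = counitGen x := lift_gen _ _ x

instance : Bialgebra k (Hq q) :=
  Bialgebra.ofAlgHom (comulHom q) (counitHom q)
    (by
      refine algHom_ext fun x => ?_
      cases x <;>
        simp [comulHom_gen, comulGen, TensorProduct.add_tmul, TensorProduct.tmul_add,
          add_assoc, Algebra.TensorProduct.one_def])
    (by
      refine algHom_ext fun x => ?_
      cases x <;> simp [comulHom_gen, counitHom_gen, comulGen, counitGen])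
    (by
      refine algHom_ext fun x => ?_
      cases x <;> simp [comulHom_gen, counitHom_gen, comulGen, counitGen])

open Classical in
variable (q) in
/-- The universal deformation formula `exp_q (t D₁ ⊗ D₂) ∈ (H_q ⊗ H_q)⟦t⟧`, that is, the sum of
`(t D₁ ⊗ D₂) ^ i / (i)_q!` over `i < n` if `q` is a primitive `n`th root of unity with `n ≥ 2`, and
over all `i ≥ 0` otherwise. -/
def expq : PowerSeries (Hq q ⊗[k] Hq q) :=
  PowerSeries.mk fun i =>
    if ∃ n, 2 ≤ n ∧ IsPrimitiveRoot (q : k) n ∧ n ≤ i then 0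
    else (qFactorial (q : k) i)⁻¹ • (D1 q ⊗ₜ[k] D2 q) ^ i

end Hq

end Hq

/-! ### Quantum symmetric algebras and their smash products -/

section QSym

variable {k V ι : Type*} [Field k] [AddCommGroup V] [Module k V]

/-- The relations `wᵢ wⱼ = qᵢⱼ wⱼ wᵢ` on the tensor algebra of `V`. -/
inductive QSymRel (w : Module.Basis ι k V) (Q : ι → ι → kˣ) :
    TensorAlgebra k V → TensorAlgebra k V → Prop
  | rel (i j : ι) : QSymRel w Q (TensorAlgebra.ι k (w i) * TensorAlgebra.ι k (w j))
      ((Q i j : k) • (TensorAlgebra.ι k (w j) * TensorAlgebra.ι k (w i)))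

/-- The quantum symmetric algebra of `V` with respect to the basis `w` and the scalars `Q`. -/
def QSym (w : Module.Basis ι k V) (Q : ι → ι → kˣ) : Type _ := RingQuot (QSymRel w Q)

/-- The linear action of `G` on `V` is diagonal with respect to the basis `w`. -/
class IsDiagonalAction (G : Type*) [Group G] [DistribMulAction G V]
    (w : Module.Basis ι k V) : Prop where
  exists_smul_eq : ∀ (g : G) (i : ι), ∃ c : kˣ, g • w i = (c : k) • w i

namespace QSym

variable (w : Module.Basis ι k V) (Q : ι → ι → kˣ)

instance : Ring (QSym w Q) := inferInstanceAs (Ring (RingQuot (QSymRel w Q)))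

instance : Algebra k (QSym w Q) := inferInstanceAs (Algebra k (RingQuot (QSymRel w Q)))

def mk : TensorAlgebra k V →ₐ[k] QSym w Q := RingQuot.mkAlgHom k (QSymRel w Q)

/-- The canonical map from `V` to the quantum symmetric algebra. -/
def of : V →ₗ[k] QSym w Q := (mk w Q).toLinearMap ∘ₗ TensorAlgebra.ι k

theorem of_mul_of (i j : ι) :
    of w Q (w i) * of w Q (w j) = (Q i j : k) • (of w Q (w j) * of w Q (w i)) := by
  have := RingQuot.mkAlgHom_rel k (QSymRel.rel (w := w) (Q := Q) i j)
  rw [map_mul, map_smul, map_mul] at this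
  exact this

variable {w Q}

theorem algHom_ext {R : Type*} [Semiring R] [Algebra k R] {f g : QSym w Q →ₐ[k] R}
    (h : ∀ v, f (of w Q v) = g (of w Q v)) : f = g := by
  refine RingQuot.ringQuot_ext' k f g (TensorAlgebra.hom_ext (LinearMap.ext fun v => ?_))
  exact h v

variable {G : Type*} [Group G] [DistribMulAction G V] [SMulCommClass G k V]
  [IsDiagonalAction G w]

theorem lift_rel (g : G) ⦃x y : TensorAlgebra k V⦄ (h : QSymRel w Q x y) :
    TensorAlgebra.lift k (of w Q ∘ₗ DistribSMul.toLinearMap k V g) x =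
      TensorAlgebra.lift k (of w Q ∘ₗ DistribSMul.toLinearMap k V g) y := by
  obtain ⟨i, j⟩ := h
  obtain ⟨c, hc⟩ := IsDiagonalAction.exists_smul_eq (w := w) g i
  obtain ⟨d, hd⟩ := IsDiagonalAction.exists_smul_eq (w := w) g j
  simp only [map_mul, map_smul, TensorAlgebra.lift_ι_apply, LinearMap.comp_apply,
    DistribSMul.toLinearMap_apply, hc, hd, smul_mul_assoc, mul_smul_comm, of_mul_of w Q i j]
  simp only [smul_smul]
  congr 1
  ring

variable (w Q) in
/-- The algebra endomorphism of the quantum symmetric algebra that extends `v ↦ g • v`. -/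
def actHom (g : G) : QSym w Q →ₐ[k] QSym w Q :=
  RingQuot.liftAlgHom k
    ⟨TensorAlgebra.lift k (of w Q ∘ₗ DistribSMul.toLinearMap k V g), lift_rel g⟩

theorem actHom_of (g : G) (v : V) : actHom w Q g (of w Q v) = of w Q (g • v) := by
  have := RingQuot.liftAlgHom_mkAlgHom_apply k
    (TensorAlgebra.lift k (of w Q ∘ₗ DistribSMul.toLinearMap k V g)) (s := QSymRel w Q)
    (lift_rel g) (TensorAlgebra.ι k v)
  rw [TensorAlgebra.lift_ι_apply] at this
  exact this

/-- The action of `G` on the quantum symmetric algebra by algebra automorphisms that extends the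
action on `V`. -/
instance : MulSemiringAction G (QSym w Q) where
  smul g x := actHom w Q g x
  one_smul x := by
    have : actHom w Q (1 : G) = AlgHom.id k _ := algHom_ext fun v => by simp [actHom_of]
    exact DFunLike.congr_fun this x
  mul_smul g h x := by
    have : actHom w Q (g * h) = (actHom w Q g).comp (actHom w Q h) :=
      algHom_ext fun v => by simp [actHom_of, mul_smul]
    exact DFunLike.congr_fun this x
  smul_zero g := map_zero (actHom w Q g)
  smul_add g := map_add (actHom w Q g)
  smul_one g := map_one (actHom w Q g)
  smul_mul g := map_mul (actHom w Q g)

theorem smul_of (g : G) (v : V) : g • of w Q v = of w Q (g • v) := actHom_of g v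

instance : SMulCommClass G k (QSym w Q) where
  smul_comm g c x := map_smul (actHom w Q g) c x

end QSym

/-- The smash product `S_Q(V) # G`; the element `a # g` is `SkewMonoidAlgebra.single g a`, and
`(a # g) (b # h) = a (g • b) # g h`. -/
abbrev Smash (w : Module.Basis ι k V) (Q : ι → ι → kˣ) (G : Type*) : Type _ :=
  SkewMonoidAlgebra (QSym w Q) G

end QSym

end QuantumSmash

end

open QuantumSmash

/-! Associativity is the functional equation of the quantum exponential. The quantum binomial
theorem expands `D₁ ^ i` and `D₂ ^ i` on products, and `1/(l+m)_q!` times a Gaussian binomial equals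
`1/((l)_q! (m)_q!)`. Both bracketings of `a * b * c` then become the same sum, over triples `(l, m,
j)`, of `D₁^(l+j) a · σ^l D₁^m D₂^j b · D₂^(l+m) c` with coefficient `1/((l)_q! (m)_q! (j)_q!)`. At
a root of unity the truncation does no harm, since `D₁ ^ n = D₂ ^ n = 0` (`isAssocSeq_twist_expq`).
The coefficient of `t` in associativity is the cocycle condition.

Nontriviality reduces to showing that `μ₁` is not a coboundary, because an isomorphism `φ₀ + φ₁ t +
⋯` to the undeformed algebra makes `μ₁` the coboundary of `φ₀⁻¹ φ₁`.

The obstruction is the combination `μ₁(w₁ ⊗ w₂) - q₁₂ μ₁(w₂ ⊗ w₁)`. For a coboundary every surviving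
term has `w₁` or `w₂` as a factor, so it dies when these generators are set to zero
(`projection_coeff_hochschildD1_sub`). For the given `μ₁` it is `P₁ g₁(P₂) # g₁g₂`, which this
projection fixes and which is nonzero because `S_q(V)` is a domain (`QSym.mul_ne_zero_of_ne_zero`).
-/

namespace QuantumSmash

/-! ### Formal deformations: associativity, unit, infinitesimal -/

section Deformations

variable {k A : Type*} [Field k] [Ring A] [Algebra k A]

/-- Both nestings range over five exponents with sum `N`: two from `μ`, three from the power series.
This lemma and the next bring the two bracketings to one common order of summation, with the
exponents of `μ` innermost, where `IsAssocSeq` applies. -/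
theorem sum_antidiagonal_starMul_left {M : Type*} [AddCommMonoid M] (F : ℕ → ℕ → ℕ → ℕ → ℕ → M)
    (N : ℕ) :
    ∑ p ∈ Finset.HasAntidiagonal.antidiagonal N, ∑ s ∈ Finset.HasAntidiagonal.antidiagonal p.2,
      ∑ p' ∈ Finset.HasAntidiagonal.antidiagonal s.1,
        ∑ s' ∈ Finset.HasAntidiagonal.antidiagonal p'.2, F p.1 p'.1 s'.1 s'.2 s.2 =
    ∑ p ∈ Finset.HasAntidiagonal.antidiagonal N, ∑ u ∈ Finset.HasAntidiagonal.antidiagonal p.2,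
      ∑ v ∈ Finset.HasAntidiagonal.antidiagonal u.2,
        ∑ e ∈ Finset.HasAntidiagonal.antidiagonal p.1, F e.1 e.2 u.1 v.1 v.2 := by
  simp_rw [Finset.sum_sigma']
  refine Finset.sum_nbij'
    (fun ⟨p, s, p', s'⟩ => ⟨(p.1 + p'.1, s'.1 + (s'.2 + s.2)), (s'.1, s'.2 + s.2), (s'.2, s.2),
      (p.1, p'.1)⟩)
    (fun ⟨_, u, v, e⟩ => ⟨(e.1, e.2 + (u.1 + v.1) + v.2), (e.2 + (u.1 + v.1), v.2),
      (e.2, u.1 + v.1), (u.1, v.1)⟩) ?_ ?_ ?_ ?_ ?_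
  · rintro ⟨⟨a, b⟩, ⟨c, d⟩, ⟨e, f⟩, ⟨g, h⟩⟩ hx
    simp only [Finset.mem_sigma, Finset.HasAntidiagonal.mem_antidiagonal] at hx ⊢
    exact ⟨by omega, trivial, trivial, trivial⟩
  · rintro ⟨⟨a, b⟩, ⟨c, d⟩, ⟨e, f⟩, ⟨g, h⟩⟩ hx
    simp only [Finset.mem_sigma, Finset.HasAntidiagonal.mem_antidiagonal] at hx ⊢
    exact ⟨by omega, trivial, trivial, trivial⟩
  · rintro ⟨⟨a, b⟩, ⟨c, d⟩, ⟨e, f⟩, ⟨g, h⟩⟩ hx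
    simp only [Finset.mem_sigma, Finset.HasAntidiagonal.mem_antidiagonal] at hx
    obtain ⟨rfl, rfl, rfl, rfl⟩ := hx
    rfl
  · rintro ⟨⟨a, b⟩, ⟨c, d⟩, ⟨e, f⟩, ⟨g, h⟩⟩ hx
    simp only [Finset.mem_sigma, Finset.HasAntidiagonal.mem_antidiagonal] at hx
    obtain ⟨rfl, rfl, rfl, rfl⟩ := hx
    rfl
  · rintro ⟨⟨a, b⟩, ⟨c, d⟩, ⟨e, f⟩, ⟨g, h⟩⟩ hx
    rfl

theorem sum_antidiagonal_starMul_right {M : Type*} [AddCommMonoid M] (F : ℕ → ℕ → ℕ → ℕ → ℕ → M)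
    (N : ℕ) :
    ∑ p ∈ Finset.HasAntidiagonal.antidiagonal N, ∑ s ∈ Finset.HasAntidiagonal.antidiagonal p.2,
      ∑ p' ∈ Finset.HasAntidiagonal.antidiagonal s.2,
        ∑ s' ∈ Finset.HasAntidiagonal.antidiagonal p'.2, F p.1 p'.1 s.1 s'.1 s'.2 =
    ∑ p ∈ Finset.HasAntidiagonal.antidiagonal N, ∑ u ∈ Finset.HasAntidiagonal.antidiagonal p.2,
      ∑ v ∈ Finset.HasAntidiagonal.antidiagonal u.2,
        ∑ e ∈ Finset.HasAntidiagonal.antidiagonal p.1, F e.1 e.2 u.1 v.1 v.2 := by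
  simp_rw [Finset.sum_sigma']
  refine Finset.sum_nbij'
    (fun ⟨p, s, p', s'⟩ => ⟨(p.1 + p'.1, s.1 + (s'.1 + s'.2)), (s.1, s'.1 + s'.2), (s'.1, s'.2),
      (p.1, p'.1)⟩)
    (fun ⟨_, u, v, e⟩ => ⟨(e.1, u.1 + (e.2 + (v.1 + v.2))), (u.1, e.2 + (v.1 + v.2)),
      (e.2, v.1 + v.2), (v.1, v.2)⟩) ?_ ?_ ?_ ?_ ?_
  · rintro ⟨⟨a, b⟩, ⟨c, d⟩, ⟨e, f⟩, ⟨g, h⟩⟩ hx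
    simp only [Finset.mem_sigma, Finset.HasAntidiagonal.mem_antidiagonal] at hx ⊢
    exact ⟨by omega, trivial, trivial, trivial⟩
  · rintro ⟨⟨a, b⟩, ⟨c, d⟩, ⟨e, f⟩, ⟨g, h⟩⟩ hx
    simp only [Finset.mem_sigma, Finset.HasAntidiagonal.mem_antidiagonal] at hx ⊢
    exact ⟨by omega, trivial, trivial, trivial⟩
  · rintro ⟨⟨a, b⟩, ⟨c, d⟩, ⟨e, f⟩, ⟨g, h⟩⟩ hx
    simp only [Finset.mem_sigma, Finset.HasAntidiagonal.mem_antidiagonal] at hx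
    obtain ⟨rfl, rfl, rfl, rfl⟩ := hx
    rfl
  · rintro ⟨⟨a, b⟩, ⟨c, d⟩, ⟨e, f⟩, ⟨g, h⟩⟩ hx
    simp only [Finset.mem_sigma, Finset.HasAntidiagonal.mem_antidiagonal] at hx
    obtain ⟨rfl, rfl, rfl, rfl⟩ := hx
    rfl
  · rintro ⟨⟨a, b⟩, ⟨c, d⟩, ⟨e, f⟩, ⟨g, h⟩⟩ hx
    rfl

theorem sum_antidiagonal_one {M : Type*} [AddCommMonoid M] (F : ℕ × ℕ → M) :
    ∑ p ∈ Finset.HasAntidiagonal.antidiagonal 1, F p = F (0, 1) + F (1, 0) :=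
  (Finset.Nat.sum_antidiagonal_eq_sum_range_succ_mk F 1).trans (by simp [Finset.sum_range_succ])

/-- The equations between the coefficients of a deformation that express associativity. -/
def IsAssocSeq (μ : ℕ → A ⊗[k] A →ₗ[k] A) : Prop :=
  ∀ n a b c,
    ∑ p ∈ Finset.HasAntidiagonal.antidiagonal n, μ p.1 (μ p.2 (a ⊗ₜ b) ⊗ₜ c) =
      ∑ p ∈ Finset.HasAntidiagonal.antidiagonal n, μ p.1 (a ⊗ₜ μ p.2 (b ⊗ₜ c))

theorem IsAssocSeq.starMul_assoc {μ : ℕ → A ⊗[k] A →ₗ[k] A} (hμ : IsAssocSeq μ)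
    (f g h : PowerSeries A) : starMul μ (starMul μ f g) h = starMul μ f (starMul μ g h) := by
  ext N
  simp only [starMul, PowerSeries.coeff_mk, TensorProduct.sum_tmul, TensorProduct.tmul_sum, map_sum]
  rw [sum_antidiagonal_starMul_left (fun i j x y z => μ i (μ j (PowerSeries.coeff x f ⊗ₜ
      PowerSeries.coeff y g) ⊗ₜ PowerSeries.coeff z h)),
    sum_antidiagonal_starMul_right (fun i j x y z => μ i (PowerSeries.coeff x f ⊗ₜ
      μ j (PowerSeries.coeff y g ⊗ₜ PowerSeries.coeff z h)))]
  refine Finset.sum_congr rfl fun p _ => Finset.sum_congr rfl fun u _ =>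
    Finset.sum_congr rfl fun v _ => hμ _ _ _ _

theorem starMul_one_left {μ : ℕ → A ⊗[k] A →ₗ[k] A} (h0 : ∀ a, μ 0 (1 ⊗ₜ a) = a)
    (h : ∀ n a, n ≠ 0 → μ n (1 ⊗ₜ a) = 0) (f : PowerSeries A) : starMul μ 1 f = f := by
  ext n
  simp only [starMul, PowerSeries.coeff_mk]
  rw [Finset.sum_eq_single (0, n), Finset.sum_eq_single (0, n)]
  · simp [h0]
  · rintro ⟨i, j⟩ hs hne
    rw [Finset.HasAntidiagonal.mem_antidiagonal] at hs
    have : i ≠ 0 := by rintro rfl; exact hne (by simpa using hs)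
    simp [PowerSeries.coeff_one, this]
  · simp
  · rintro ⟨i, j⟩ hs hne
    rw [Finset.HasAntidiagonal.mem_antidiagonal] at hs
    have : i ≠ 0 := by rintro rfl; exact hne (by simpa using hs)
    refine Finset.sum_eq_zero fun s _ => ?_
    rw [PowerSeries.coeff_one]
    split_ifs
    · exact h _ _ this
    · simp
  · simp

theorem starMul_one_right {μ : ℕ → A ⊗[k] A →ₗ[k] A} (h0 : ∀ a, μ 0 (a ⊗ₜ 1) = a)
    (h : ∀ n a, n ≠ 0 → μ n (a ⊗ₜ 1) = 0) (f : PowerSeries A) : starMul μ f 1 = f := by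
  ext n
  simp only [starMul, PowerSeries.coeff_mk]
  rw [Finset.sum_eq_single (0, n), Finset.sum_eq_single (n, 0)]
  · simp [h0]
  · rintro ⟨i, j⟩ hs hne
    rw [Finset.HasAntidiagonal.mem_antidiagonal] at hs
    have : j ≠ 0 := by rintro rfl; exact hne (by simpa using hs)
    simp [PowerSeries.coeff_one, this]
  · simp
  · rintro ⟨i, j⟩ hs hne
    rw [Finset.HasAntidiagonal.mem_antidiagonal] at hs
    have : i ≠ 0 := by rintro rfl; exact hne (by simpa using hs)
    refine Finset.sum_eq_zero fun s _ => ?_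
    rw [PowerSeries.coeff_one]
    split_ifs
    · exact h _ _ this
    · simp
  · simp

theorem IsAssocSeq.hochschildD2_eq_zero {μ : ℕ → A ⊗[k] A →ₗ[k] A} (hμ : IsAssocSeq μ)
    (h0 : μ 0 = LinearMap.mul' k A) : hochschildD2 k A (μ 1) = 0 := by
  ext a b c
  have h := hμ 1 a b c
  simp only [sum_antidiagonal_one, h0, LinearMap.mul'_apply] at h
  simp only [TensorProduct.AlgebraTensorModule.curry_apply, LinearMap.restrictScalars_self,
    TensorProduct.curry_apply, hochschildD2_apply, LinearMap.zero_apply]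
  rw [← sub_eq_zero] at h
  rw [← neg_eq_zero, ← h]
  abel

/-- If a deformation is trivial, then its infinitesimal is a coboundary. -/
theorem IsTrivialDeformation.exists_hochschildD1_eq {μ : ℕ → A ⊗[k] A →ₗ[k] A}
    (h0 : μ 0 = LinearMap.mul' k A) (h : IsTrivialDeformation μ) :
    ∃ f : A →ₗ[k] A, hochschildD1 k A f = μ 1 := by
  obtain ⟨Φ, hsmul, hmul⟩ := h
  have hX : ∀ f, Φ (PowerSeries.X * f) = PowerSeries.X * Φ f := fun f => by
    simpa using hsmul PowerSeries.X f
  have hX' : ∀ f, Φ.symm (PowerSeries.X * f) = PowerSeries.X * Φ.symm f := fun f => by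
    rw [AddEquiv.symm_apply_eq, hX, AddEquiv.apply_symm_apply]
  have hC : ∀ (c : k) (a : A), Φ (PowerSeries.C (c • a)) =
      PowerSeries.C (algebraMap k A c) * Φ (PowerSeries.C a) := fun c a => by
    have := hsmul (PowerSeries.C c) (PowerSeries.C a)
    rwa [PowerSeries.map_C, ← map_mul, ← Algebra.smul_def] at this
  have split : ∀ f : PowerSeries A, f = PowerSeries.X *
      (PowerSeries.mk fun p => PowerSeries.coeff (p + 1) f) +
        PowerSeries.C (PowerSeries.coeff 0 f) := fun f => by
    simpa using PowerSeries.eq_X_mul_shift_add_const f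
  -- An additive map that commutes with `X` descends to the quotient by `X`. Applied to `Φ` and to
  -- `Φ.symm`, this shows that `φ 0` is bijective.
  have red : ∀ (Ψ : PowerSeries A ≃+ PowerSeries A)
      (_ : ∀ f, Ψ (PowerSeries.X * f) = PowerSeries.X * Ψ f) (f : PowerSeries A),
      PowerSeries.coeff 0 (Ψ f) =
        PowerSeries.coeff 0 (Ψ (PowerSeries.C (PowerSeries.coeff 0 f))) := fun Ψ hΨ f => by
    conv_lhs => rw [split f, map_add, hΨ]
    simp
  let φ : ℕ → A →ₗ[k] A := fun n =>
    { toFun := fun a => PowerSeries.coeff n (Φ (PowerSeries.C a))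
      map_add' := fun a b => by simp
      map_smul' := fun c a => by rw [hC, PowerSeries.coeff_C_mul, Algebra.smul_def, RingHom.id_apply] }
  let ψ : A → A := fun a => PowerSeries.coeff 0 (Φ.symm (PowerSeries.C a))
  have hl : Function.LeftInverse ψ (φ 0) := fun a => by
    change PowerSeries.coeff 0 (Φ.symm (PowerSeries.C (PowerSeries.coeff 0 _))) = a
    rw [← red Φ.symm hX']; simp
  have hr : Function.RightInverse ψ (φ 0) := fun a => by
    change PowerSeries.coeff 0 (Φ (PowerSeries.C (PowerSeries.coeff 0 _))) = a
    rw [← red Φ hX]; simp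
  let e : A ≃ₗ[k] A := LinearEquiv.ofBijective (φ 0) ⟨hl.injective, hr.surjective⟩
  have he : ∀ a, e a = φ 0 a := fun _ => rfl
  have hstar : ∀ a b n, PowerSeries.coeff n (starMul μ (PowerSeries.C a) (PowerSeries.C b)) =
      μ n (a ⊗ₜ b) := fun a b n => by
    simp only [starMul, PowerSeries.coeff_mk]
    rw [Finset.sum_eq_single (n, 0), Finset.sum_eq_single (0, 0)]
    · simp
    · rintro ⟨i, j⟩ hs hne
      have : ¬(i = 0 ∧ j = 0) := by rintro ⟨rfl, rfl⟩; exact hne rfl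
      have hij : i + j = 0 := Finset.HasAntidiagonal.mem_antidiagonal.1 hs
      omega
    · simp
    · rintro ⟨i, j⟩ hs hne
      rw [Finset.HasAntidiagonal.mem_antidiagonal] at hs
      have : j ≠ 0 := by rintro rfl; exact hne (by simpa using hs)
      refine Finset.sum_eq_zero fun s hs => ?_
      rw [Finset.HasAntidiagonal.mem_antidiagonal] at hs
      simp only at hs
      simp only [PowerSeries.coeff_C]
      by_cases h1 : s.1 = 0
      · have h2 : s.2 ≠ 0 := by omega
        simp [h2]
      · simp [h1]
    · simp
  have key0 : ∀ a b, φ 0 (a * b) = φ 0 a * φ 0 b := fun a b => by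
    have := congrArg (PowerSeries.coeff 0) (hmul (PowerSeries.C a) (PowerSeries.C b))
    rw [red Φ hX, hstar, h0, LinearMap.mul'_apply, PowerSeries.coeff_mul,
      Finset.Nat.antidiagonal_zero, Finset.sum_singleton] at this
    exact this
  -- Multiplicativity of `Φ` on constants, read off at `t ^ 1`. Applying the inverse of `φ 0`, which
  -- is multiplicative by `key0`, turns it into the coboundary equation.
  have key1 : ∀ a b, φ 1 (a * b) + φ 0 (μ 1 (a ⊗ₜ b)) = φ 0 a * φ 1 b + φ 1 a * φ 0 b :=
    fun a b => by
    have := congrArg (PowerSeries.coeff 1) (hmul (PowerSeries.C a) (PowerSeries.C b))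
    rw [split (starMul μ _ _), map_add, hX, map_add, hstar, h0, LinearMap.mul'_apply,
      ← zero_add 1, PowerSeries.coeff_succ_X_mul, red Φ hX, PowerSeries.coeff_mul, zero_add,
      sum_antidiagonal_one, PowerSeries.coeff_mk, hstar] at this
    rw [add_comm]
    exact this
  refine ⟨e.symm.toLinearMap ∘ₗ φ 1, ?_⟩
  ext a b
  simp only [TensorProduct.AlgebraTensorModule.curry_apply, LinearMap.restrictScalars_self,
    TensorProduct.curry_apply, hochschildD1_apply, LinearMap.comp_apply, LinearEquiv.coe_coe]
  apply e.injective
  have hφe : ∀ a, φ 0 (e.symm a) = a := fun a => e.apply_symm_apply a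
  rw [he, he, map_add, map_sub, key0, key0, hφe, hφe, hφe, sub_add_eq_add_sub, ← key1]
  abel

end Deformations

/-! ### The universal deformation formula `exp_q (t D₁ ⊗ D₂)` -/

section Hq

variable {k A : Type*} [Field k] [Ring A] [Algebra k A] {q : kˣ} [Module (Hq q) A]
  [IsScalarTower k (Hq q) A]

open Classical in
variable (q) in
/-- The coefficient of `(D₁ ⊗ D₂) ^ i` in `exp_q (t D₁ ⊗ D₂)`. -/
noncomputable def expqCoeff (i : ℕ) : k :=
  if ∃ n, 2 ≤ n ∧ IsPrimitiveRoot (q : k) n ∧ n ≤ i then 0 else (qFactorial (q : k) i)⁻¹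

theorem twist_expq_tmul (i : ℕ) (a b : A) :
    twist (Hq.expq q) i (a ⊗ₜ[k] b) = expqCoeff q i • (Hq.D1 q ^ i • a * Hq.D2 q ^ i • b) := by
  rw [twist_tmul, Hq.expq, PowerSeries.coeff_mk, expqCoeff]
  split_ifs
  · simp
  · rw [map_smul, Algebra.TensorProduct.tmul_pow, applyPair_tmul]

theorem expqCoeff_zero : expqCoeff q 0 = 1 := by
  rw [expqCoeff, if_neg (by rintro ⟨n, h1, -, h2⟩; omega)]
  simp [qFactorial]

theorem expqCoeff_one : expqCoeff q 1 = 1 := by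
  rw [expqCoeff, if_neg (by rintro ⟨n, h1, -, h2⟩; omega)]
  simp [qFactorial, qInt]

/-- If `(j + 1)_q = 0` then `q ^ (j + 1) = 1`, so `q` is a primitive root of unity of order at most
`j + 1 ≤ i`. Order `1` is excluded by characteristic zero, as `(j + 1)_1 = j + 1`. -/
theorem qFactorial_ne_zero_of_forall [CharZero k] {i : ℕ}
    (h : ¬∃ n, 2 ≤ n ∧ IsPrimitiveRoot (q : k) n ∧ n ≤ i) : qFactorial (q : k) i ≠ 0 := by
  refine Finset.prod_ne_zero_iff.2 fun j hj hz => h ?_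
  rw [Finset.mem_range] at hj
  have hpow : (q : k) ^ (j + 1) = 1 := by
    have := geom_sum_mul (q : k) (j + 1)
    rw [qInt] at hz
    rw [hz, zero_mul] at this
    exact sub_eq_zero.1 this.symm
  have hle : orderOf (q : k) ≤ j + 1 := orderOf_le_of_pow_eq_one (by omega) hpow
  have hpos : 0 < orderOf (q : k) := orderOf_pos_iff.2 (isOfFinOrder_iff_pow_eq_one.2
    ⟨j + 1, by omega, hpow⟩)
  refine ⟨orderOf (q : k), ?_, IsPrimitiveRoot.orderOf _, by omega⟩
  by_contra hlt
  have h1 : (q : k) = 1 := orderOf_eq_one_iff.1 (by omega)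
  rw [h1] at hz
  simp only [qInt, one_pow, Finset.sum_const, Finset.card_range, nsmul_eq_mul, mul_one] at hz
  exact Nat.cast_ne_zero.2 (by omega) hz

theorem expqCoeff_add_mul_qChoose [CharZero k] {i j : ℕ}
    (h : ¬∃ n, 2 ≤ n ∧ IsPrimitiveRoot (q : k) n ∧ n ≤ i + j) :
    expqCoeff q (i + j) * qChoose (q : k) (i + j) i = expqCoeff q i * expqCoeff q j := by
  have hi : ¬∃ n, 2 ≤ n ∧ IsPrimitiveRoot (q : k) n ∧ n ≤ i :=
    fun ⟨n, h1, h2, h3⟩ => h ⟨n, h1, h2, by omega⟩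
  have hj : ¬∃ n, 2 ≤ n ∧ IsPrimitiveRoot (q : k) n ∧ n ≤ j :=
    fun ⟨n, h1, h2, h3⟩ => h ⟨n, h1, h2, by omega⟩
  rw [expqCoeff, expqCoeff, expqCoeff, if_neg h, if_neg hi, if_neg hj]
  have f := qFactorial_ne_zero_of_forall h
  have fi := qFactorial_ne_zero_of_forall hi
  have fj := qFactorial_ne_zero_of_forall hj
  have := qChoose_mul (q : k) (i + j) i j rfl
  field_simp
  linear_combination this

/-- The scalars alone need not agree once `i + j ≥ n`: the left one is truncated to zero, while the
right one is nonzero if `i, j < n`. Multiplied by `D₁ ^ (i + j) = 0`, they do. -/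
theorem expqCoeff_smul_D1_pow [CharZero k] (i j : ℕ) :
    (expqCoeff q (i + j) * qChoose (q : k) (i + j) i) • Hq.D1 q ^ (i + j) =
      (expqCoeff q i * expqCoeff q j) • Hq.D1 q ^ (i + j) := by
  by_cases h : ∃ n, 2 ≤ n ∧ IsPrimitiveRoot (q : k) n ∧ n ≤ i + j
  · obtain ⟨n, h1, h2, h3⟩ := h
    rw [pow_eq_zero_of_le h3 (Hq.D1_pow h1 h2), smul_zero, smul_zero]
  · rw [expqCoeff_add_mul_qChoose h]

theorem expqCoeff_smul_D2_pow [CharZero k] (i j : ℕ) :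
    (expqCoeff q (i + j) * qChoose (q : k) (i + j) i) • Hq.D2 q ^ (i + j) =
      (expqCoeff q i * expqCoeff q j) • Hq.D2 q ^ (i + j) := by
  by_cases h : ∃ n, 2 ≤ n ∧ IsPrimitiveRoot (q : k) n ∧ n ≤ i + j
  · obtain ⟨n, h1, h2, h3⟩ := h
    rw [pow_eq_zero_of_le h3 (Hq.D2_pow h1 h2), smul_zero, smul_zero]
  · rw [expqCoeff_add_mul_qChoose h]

theorem comul_gen (x : HqGen) :
    Coalgebra.comul (R := k) (Hq.gen q x) = Hq.comulGen q x := Hq.comulHom_gen x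

theorem counit_gen (x : HqGen) :
    Coalgebra.counit (R := k) (Hq.gen q x) = Hq.counitGen (k := k) x := Hq.counitHom_gen x

theorem twist_expq_zero : twist (A := A) (Hq.expq q) 0 = LinearMap.mul' k A := by
  ext a b
  simp [twist_expq_tmul, expqCoeff_zero]

theorem twist_expq_one (a b : A) :
    twist (Hq.expq q) 1 (a ⊗ₜ[k] b) = (Hq.D1 q • a) * (Hq.D2 q • b) := by
  simp [twist_expq_tmul, expqCoeff_one]

variable [IsModuleAlgebra k (Hq q) A]

/-- The summands `x = D₁ ⊗ σ` and `y = 1 ⊗ D₁` of the coproduct satisfy `y x = q x y`, so the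
quantum binomial theorem computes `Δ(D₁) ^ i`. -/
theorem D1_pow_smul_mul (i : ℕ) (a b : A) :
    Hq.D1 q ^ i • (a * b) = ∑ l ∈ Finset.range (i + 1), qChoose (q : k) i l •
      ((Hq.D1 q ^ l • a) * ((Hq.s q ^ l * Hq.D1 q ^ (i - l)) • b)) := by
  rw [IsModuleAlgebra.smul_mul (k := k), Bialgebra.comul_pow, comul_gen, Hq.comulGen,
    add_pow_of_qComm (q : k), map_sum]
  · simp [applyPair_tmul, Algebra.TensorProduct.tmul_pow]
  · simp [Hq.D1_s]

theorem D2_pow_smul_mul (i : ℕ) (a b : A) :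
    Hq.D2 q ^ i • (a * b) = ∑ l ∈ Finset.range (i + 1), qChoose (q : k) i l •
      (((Hq.s q ^ l * Hq.D2 q ^ (i - l)) • a) * (Hq.D2 q ^ l • b)) := by
  -- The summands are exchanged because here `σ ⊗ D₂` must play the role of `x` and `D₂ ⊗ 1` that of
  -- `y`.
  rw [IsModuleAlgebra.smul_mul (k := k), Bialgebra.comul_pow, comul_gen, Hq.comulGen,
    add_comm, add_pow_of_qComm (q : k), map_sum]
  · simp [applyPair_tmul, Algebra.TensorProduct.tmul_pow]
  · simp [Hq.D2_s, TensorProduct.smul_tmul']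

theorem D1_pow_smul_one {i : ℕ} (hi : i ≠ 0) : Hq.D1 q ^ i • (1 : A) = 0 := by
  rw [IsModuleAlgebra.smul_one (k := k), Bialgebra.counit_pow, counit_gen]
  simp [Hq.counitGen, hi]

theorem D2_pow_smul_one {i : ℕ} (hi : i ≠ 0) : Hq.D2 q ^ i • (1 : A) = 0 := by
  rw [IsModuleAlgebra.smul_one (k := k), Bialgebra.counit_pow, counit_gen]
  simp [Hq.counitGen, hi]

theorem sum_antidiagonal_antidiagonal_swap {M : Type*} [AddCommMonoid M] (T : ℕ → ℕ → ℕ → M)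
    (n : ℕ) :
    ∑ p ∈ Finset.HasAntidiagonal.antidiagonal n, ∑ u ∈ Finset.HasAntidiagonal.antidiagonal p.1,
      T u.1 u.2 p.2 =
    ∑ p ∈ Finset.HasAntidiagonal.antidiagonal n, ∑ u ∈ Finset.HasAntidiagonal.antidiagonal p.1,
      T u.1 p.2 u.2 := by
  simp_rw [Finset.sum_sigma']
  refine Finset.sum_nbij' (fun ⟨p, u⟩ => ⟨(u.1 + p.2, u.2), (u.1, p.2)⟩)
    (fun ⟨p, u⟩ => ⟨(u.1 + p.2, u.2), (u.1, p.2)⟩) ?_ ?_ ?_ ?_ ?_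
  · rintro ⟨⟨a, b⟩, ⟨c, d⟩⟩ hx
    simp only [Finset.mem_sigma, Finset.HasAntidiagonal.mem_antidiagonal] at hx ⊢
    exact ⟨by omega, trivial⟩
  · rintro ⟨⟨a, b⟩, ⟨c, d⟩⟩ hx
    simp only [Finset.mem_sigma, Finset.HasAntidiagonal.mem_antidiagonal] at hx ⊢
    exact ⟨by omega, trivial⟩
  · rintro ⟨⟨a, b⟩, ⟨c, d⟩⟩ hx
    simp only [Finset.mem_sigma, Finset.HasAntidiagonal.mem_antidiagonal] at hx
    obtain ⟨rfl, rfl⟩ := hx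
    rfl
  · rintro ⟨⟨a, b⟩, ⟨c, d⟩⟩ hx
    simp only [Finset.mem_sigma, Finset.HasAntidiagonal.mem_antidiagonal] at hx
    obtain ⟨rfl, rfl⟩ := hx
    rfl
  · rintro ⟨⟨a, b⟩, ⟨c, d⟩⟩ hx
    rfl

/-- `D₁ ^ i` is distributed over the inner product. The resulting Gaussian binomial and the outer
coefficient are moved onto `D₂ ^ i • c`, where `expqCoeff_smul_D2_pow` splits them. -/
theorem twist_expq_twist_expq_left [CharZero k] (i j : ℕ) (a b c : A) :
    twist (Hq.expq q) i (twist (Hq.expq q) j (a ⊗ₜ[k] b) ⊗ₜ[k] c) =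
      ∑ u ∈ Finset.HasAntidiagonal.antidiagonal i,
        (expqCoeff q u.1 * expqCoeff q u.2 * expqCoeff q j) •
          (Hq.D1 q ^ (u.1 + j) • a * (Hq.s q ^ u.1 * (Hq.D1 q ^ u.2 * Hq.D2 q ^ j)) • b *
            Hq.D2 q ^ (u.1 + u.2) • c) := by
  rw [twist_expq_tmul, twist_expq_tmul, smul_algebra_smul_comm, smul_mul_assoc, smul_comm,
    D1_pow_smul_mul, Finset.sum_mul, Finset.smul_sum, Finset.smul_sum,
    ← Finset.Nat.sum_antidiagonal_eq_sum_range_succ (fun l m => expqCoeff q j • expqCoeff q i •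
      (qChoose (q : k) i l • (Hq.D1 q ^ l • Hq.D1 q ^ j • a *
        (Hq.s q ^ l * Hq.D1 q ^ m) • Hq.D2 q ^ j • b) * Hq.D2 q ^ i • c))]
  refine Finset.sum_congr rfl fun u hu => ?_
  obtain rfl := Finset.HasAntidiagonal.mem_antidiagonal.1 hu
  rw [smul_mul_assoc, smul_smul (expqCoeff q (u.1 + u.2)), ← mul_smul_comm,
    ← smul_assoc (_ * _ : k), expqCoeff_smul_D2_pow, smul_assoc, mul_smul_comm,
    smul_smul (expqCoeff q j), smul_smul (Hq.D1 q ^ u.1), smul_smul (Hq.s q ^ u.1 * _), ← pow_add,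
    mul_assoc (Hq.s q ^ u.1), mul_comm (expqCoeff q j)]

/-- The mirror image: `D₂ ^ i` is distributed and the scalars are absorbed by `D₁ ^ i • a`. The
relation `D₁ D₂ = D₂ D₁` then gives the factor of `b` the same form as on the left. -/
theorem twist_expq_twist_expq_right [CharZero k] (i j : ℕ) (a b c : A) :
    twist (Hq.expq q) i (a ⊗ₜ[k] twist (Hq.expq q) j (b ⊗ₜ[k] c)) =
      ∑ u ∈ Finset.HasAntidiagonal.antidiagonal i,
        (expqCoeff q u.1 * expqCoeff q j * expqCoeff q u.2) •
          (Hq.D1 q ^ (u.1 + u.2) • a * (Hq.s q ^ u.1 * (Hq.D1 q ^ j * Hq.D2 q ^ u.2)) • b *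
            Hq.D2 q ^ (u.1 + j) • c) := by
  have hcomm : ∀ m, Hq.D1 q ^ j * Hq.D2 q ^ m = Hq.D2 q ^ m * Hq.D1 q ^ j := fun m =>
    (Commute.pow_pow (Hq.comm (q := q)) j m)
  rw [twist_expq_tmul, twist_expq_tmul, smul_algebra_smul_comm, mul_smul_comm, smul_comm,
    D2_pow_smul_mul, Finset.mul_sum, Finset.smul_sum, Finset.smul_sum,
    ← Finset.Nat.sum_antidiagonal_eq_sum_range_succ (fun l m => expqCoeff q j • expqCoeff q i •
      (Hq.D1 q ^ i • a * qChoose (q : k) i l • ((Hq.s q ^ l * Hq.D2 q ^ m) • Hq.D1 q ^ j • b *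
        Hq.D2 q ^ l • Hq.D2 q ^ j • c)))]
  refine Finset.sum_congr rfl fun u hu => ?_
  obtain rfl := Finset.HasAntidiagonal.mem_antidiagonal.1 hu
  rw [mul_smul_comm, smul_smul (expqCoeff q (u.1 + u.2)), ← smul_mul_assoc,
    ← smul_assoc (_ * _ : k), expqCoeff_smul_D1_pow, smul_assoc, smul_mul_assoc,
    smul_smul (expqCoeff q j), smul_smul (Hq.D2 q ^ u.1), smul_smul (Hq.s q ^ u.1 * _), ← pow_add,
    mul_assoc (Hq.s q ^ u.1), hcomm, ← mul_assoc (_ • a)]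
  congr 1
  ring

theorem isAssocSeq_twist_expq [CharZero k] : IsAssocSeq (A := A) (twist (Hq.expq q)) := by
  intro n a b c
  simp_rw [twist_expq_twist_expq_left, twist_expq_twist_expq_right]
  -- The two expansions differ only in which of `m` and `j` is the inner exponent.
  exact sum_antidiagonal_antidiagonal_swap (fun l m j =>
    (expqCoeff q l * expqCoeff q m * expqCoeff q j) •
      (Hq.D1 q ^ (l + j) • a * (Hq.s q ^ l * (Hq.D1 q ^ m * Hq.D2 q ^ j)) • b *
        Hq.D2 q ^ (l + m) • c)) n

theorem isFormalDeformation_twist_expq [CharZero k] :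
    IsFormalDeformation (A := A) (twist (Hq.expq q)) where
  zero := twist_expq_zero
  assoc := isAssocSeq_twist_expq.starMul_assoc
  unit := ⟨1, fun f => ⟨starMul_one_left (by simp [twist_expq_zero])
      (fun n a hn => by rw [twist_expq_tmul, D1_pow_smul_one hn, zero_mul, smul_zero]) f,
    starMul_one_right (by simp [twist_expq_zero])
      (fun n a hn => by rw [twist_expq_tmul, D2_pow_smul_one hn, mul_zero, smul_zero]) f⟩⟩

end Hq

/-! ### Quantum symmetric algebras: monomials and absence of zero divisors -/

namespace QSym

variable {k V ι : Type*} [Field k] [AddCommGroup V] [Module k V] {w : Module.Basis ι k V}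
  {Q : ι → ι → kˣ}

section Lift

variable {R : Type*} [Ring R] [Algebra k R]

theorem tensorAlgebra_lift_rel (f : ι → R) (h : ∀ i j, f i * f j = (Q i j : k) • (f j * f i))
    ⦃x y : TensorAlgebra k V⦄ (hxy : QSymRel w Q x y) :
    TensorAlgebra.lift k (w.constr k f) x = TensorAlgebra.lift k (w.constr k f) y := by
  obtain ⟨i, j⟩ := hxy
  simp only [map_mul, map_smul, TensorAlgebra.lift_ι_apply, Module.Basis.constr_basis, h i j]

/-- Algebra maps out of a quantum symmetric algebra from images of the basis vectors that satisfy
the relations. -/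
noncomputable def lift (f : ι → R) (h : ∀ i j, f i * f j = (Q i j : k) • (f j * f i)) :
    QSym w Q →ₐ[k] R :=
  RingQuot.liftAlgHom k ⟨TensorAlgebra.lift k (w.constr k f), tensorAlgebra_lift_rel f h⟩

theorem lift_of_basis (f : ι → R) (h : ∀ i j, f i * f j = (Q i j : k) • (f j * f i)) (i : ι) :
    lift (w := w) f h (of w Q (w i)) = f i := by
  have := RingQuot.liftAlgHom_mkAlgHom_apply k (TensorAlgebra.lift k (w.constr k f))
    (s := QSymRel w Q) (tensorAlgebra_lift_rel f h) (TensorAlgebra.ι k (w i))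
  rw [TensorAlgebra.lift_ι_apply, Module.Basis.constr_basis] at this
  exact this

end Lift

section Monomials

variable (w Q) in
/-- The product of the generators that are listed in `l`. -/
noncomputable def monomialList (l : List ι) : QSym w Q := (l.map fun i => of w Q (w i)).prod

theorem monomialList_cons (i : ι) (l : List ι) :
    monomialList w Q (i :: l) = of w Q (w i) * monomialList w Q l := by
  simp [monomialList]

theorem exists_monomialList_eq_of_perm {l l' : List ι} (h : l.Perm l') :
    ∃ c : k, monomialList w Q l = c • monomialList w Q l' := by
  induction h with
  | nil => exact ⟨1, by simp⟩
  | cons i _ ih =>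
    obtain ⟨c, hc⟩ := ih
    exact ⟨c, by rw [monomialList_cons, hc, monomialList_cons, mul_smul_comm]⟩
  | swap i j l =>
    refine ⟨Q j i, ?_⟩
    simp only [monomialList_cons, ← mul_assoc]
    rw [of_mul_of, smul_mul_assoc]
  | trans _ _ ih ih' =>
    obtain ⟨c, hc⟩ := ih
    obtain ⟨d, hd⟩ := ih'
    exact ⟨c * d, by rw [hc, hd, smul_smul]⟩

variable (w Q) in
/-- A product of generators whose multiset of indices is `m`. -/
noncomputable def monomial (m : Multiset ι) : QSym w Q := monomialList w Q m.toList

theorem of_basis_mul_monomial_mem (i : ι) (m : Multiset ι) :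
    of w Q (w i) * monomial w Q m ∈ Submodule.span k (Set.range (monomial w Q)) := by
  obtain ⟨c, hc⟩ := exists_monomialList_eq_of_perm (w := w) (Q := Q) (l := i :: m.toList)
    (l' := (i ::ₘ m).toList) (by
      rw [← Multiset.coe_eq_coe, Multiset.coe_toList, ← Multiset.cons_coe, Multiset.coe_toList])
  rw [monomial, ← monomialList_cons, hc]
  exact Submodule.smul_mem _ _ (Submodule.subset_span ⟨_, rfl⟩)

/-- The span contains `1` and is stable under left multiplication by each generator, hence by the
whole algebra. -/
theorem span_range_monomial : Submodule.span k (Set.range (monomial w Q)) = ⊤ := by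
  have hw : ∀ i, ∀ y ∈ Submodule.span k (Set.range (monomial w Q)),
      of w Q (w i) * y ∈ Submodule.span k (Set.range (monomial w Q)) := fun i y hy => by
    induction hy using Submodule.span_induction with
    | mem y hy =>
      obtain ⟨m, rfl⟩ := hy
      exact of_basis_mul_monomial_mem i m
    | zero => simp
    | add y z _ _ hy hz => rw [mul_add]; exact Submodule.add_mem _ hy hz
    | smul c y _ hy => rw [mul_smul_comm]; exact Submodule.smul_mem _ _ hy
  have hmk : ∀ t : TensorAlgebra k V, ∀ y ∈ Submodule.span k (Set.range (monomial w Q)),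
      mk w Q t * y ∈ Submodule.span k (Set.range (monomial w Q)) := fun t => by
    induction t using TensorAlgebra.induction with
    | algebraMap r =>
      intro y hy
      rw [AlgHom.commutes, ← Algebra.smul_def]
      exact Submodule.smul_mem _ _ hy
    | ι v =>
      intro y hy
      change of w Q v * y ∈ _
      induction w.mem_span v using Submodule.span_induction with
      | mem v hv =>
        obtain ⟨i, rfl⟩ := hv
        exact hw i y hy
      | zero => simp
      | add u v _ _ hu hv => rw [map_add, add_mul]; exact Submodule.add_mem _ hu hv
      | smul c v _ hv => rw [map_smul, smul_mul_assoc]; exact Submodule.smul_mem _ _ hv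
    | mul s t hs ht =>
      intro y hy
      rw [map_mul, mul_assoc]
      exact hs _ (ht y hy)
    | add s t hs ht =>
      intro y hy
      rw [map_add, add_mul]
      exact Submodule.add_mem _ (hs y hy) (ht y hy)
  refine (Submodule.eq_top_iff').2 fun x => ?_
  obtain ⟨t, rfl⟩ := RingQuot.mkAlgHom_surjective k (QSymRel w Q) x
  have h1 : (1 : QSym w Q) ∈ Submodule.span k (Set.range (monomial w Q)) :=
    Submodule.subset_span ⟨0, by simp [monomial, monomialList]⟩
  have := hmk t 1 h1
  rwa [mul_one] at this

end Monomials

section Representation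

variable [LinearOrder ι]

variable (Q) in
/-- The scalar that arises when the generator with index `i` is moved to its place in the ordered
monomial with index `m`. -/
noncomputable def orderingScalar (i : ι) (m : Multiset ι) : kˣ :=
  (m.map fun j => if j < i then Q i j else 1).prod

theorem orderingScalar_cons (i j : ι) (m : Multiset ι) :
    orderingScalar Q i (j ::ₘ m) = (if j < i then Q i j else 1) * orderingScalar Q i m := by
  simp [orderingScalar]

variable (Q) in
/-- Left multiplication by a generator on the space with basis the ordered monomials. -/
noncomputable def leftMulGen (i : ι) : Module.End k (Multiset ι →₀ k) :=
  Finsupp.lsum k fun m => (orderingScalar Q i m : k) • Finsupp.lsingle (i ::ₘ m)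

theorem leftMulGen_single (i : ι) (m : Multiset ι) (c : k) :
    leftMulGen Q i (Finsupp.single m c) =
      Finsupp.single (i ::ₘ m) (orderingScalar Q i m * c) := by
  simp [leftMulGen]

/-- For `i ≠ j`, exactly one of the two orders moves a new generator past the other, which accounts
for the factor `Q i j`. -/
theorem leftMulGen_mul_leftMulGen (hQ_diag : ∀ i, Q i i = 1) (hQ_inv : ∀ i j, Q j i = (Q i j)⁻¹)
    (i j : ι) :
    leftMulGen Q i * leftMulGen Q j = (Q i j : k) • (leftMulGen Q j * leftMulGen Q i) := by
  refine Finsupp.lhom_ext fun m c => ?_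
  have hQ : (Q i j : k) * Q j i = 1 := by rw [hQ_inv i j]; simp
  simp only [Module.End.mul_apply, LinearMap.smul_apply, leftMulGen_single, Finsupp.smul_single,
    orderingScalar_cons, smul_eq_mul, Multiset.cons_swap i j]
  congr 1
  rcases lt_trichotomy i j with h | rfl | h
  · rw [if_neg h.not_gt, if_pos h]
    push_cast
    linear_combination -(orderingScalar Q i m * orderingScalar Q j m * c : k) * hQ
  · simp [hQ_diag]
  · rw [if_pos h, if_neg h.not_gt]
    push_cast
    ring

/-- The action of a quantum symmetric algebra on the space with basis the ordered monomials. -/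
noncomputable def monomialRep (w : Module.Basis ι k V) (hQ_diag : ∀ i, Q i i = 1)
    (hQ_inv : ∀ i j, Q j i = (Q i j)⁻¹) : QSym w Q →ₐ[k] Module.End k (Multiset ι →₀ k) :=
  lift (leftMulGen Q) (leftMulGen_mul_leftMulGen hQ_diag hQ_inv)

/-- The scalar has to be a unit: this is what keeps an uncancelled term of a product nonzero. -/
theorem exists_monomialRep_monomialList (hQ_diag : ∀ i, Q i i = 1)
    (hQ_inv : ∀ i j, Q j i = (Q i j)⁻¹) (l : List ι) (m : Multiset ι) :
    ∃ c : kˣ, monomialRep w hQ_diag hQ_inv (monomialList w Q l) (Finsupp.single m 1) =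
      Finsupp.single (l + m) (c : k) := by
  induction l with
  | nil => exact ⟨1, by simp [monomialList]⟩
  | cons i l ih =>
    obtain ⟨c, hc⟩ := ih
    refine ⟨orderingScalar Q i (l + m) * c, ?_⟩
    rw [monomialList_cons, map_mul, Module.End.mul_apply, hc, monomialRep, lift_of_basis,
      leftMulGen_single, ← Multiset.cons_coe, Multiset.cons_add, Units.val_mul]

/-- Quantum symmetric algebras have no zero divisors. -/
theorem mul_ne_zero_of_ne_zero (hQ_diag : ∀ i, Q i i = 1)
    (hQ_inv : ∀ i j, Q j i = (Q i j)⁻¹) {x y : QSym w Q} (hx : x ≠ 0) (hy : y ≠ 0) : x * y ≠ 0 := by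
  have hrep : ∀ x : QSym w Q, ∃ a : Multiset ι →₀ k, x = a.sum fun m r => r • monomial w Q m :=
    fun x => by
    have : x ∈ Submodule.span k (Set.range (monomial w Q)) := by
      rw [span_range_monomial]; trivial
    obtain ⟨a, ha⟩ := Finsupp.mem_span_range_iff_exists_finsupp.1 this
    exact ⟨a, ha.symm⟩
  have hmon : ∀ m n : Multiset ι, ∃ c : kˣ,
      monomialRep w hQ_diag hQ_inv (monomial w Q m) (Finsupp.single n 1) =
        Finsupp.single (m + n) (c : k) := fun m n => by
    obtain ⟨c, hc⟩ := exists_monomialRep_monomialList (w := w) hQ_diag hQ_inv m.toList n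
    exact ⟨c, by rw [monomial, hc, Multiset.coe_toList]⟩
  choose c hc using hmon
  have hc' : ∀ m n r, monomialRep w hQ_diag hQ_inv (monomial w Q m) (Finsupp.single n r) =
      Finsupp.single (m + n) (r * (c m n : k)) := fun m n r => by
    rw [← mul_one r, ← smul_eq_mul, ← Finsupp.smul_single, map_smul, hc, Finsupp.smul_single,
      smul_eq_mul, smul_eq_mul, mul_one]
  obtain ⟨a, rfl⟩ := hrep x
  obtain ⟨b, rfl⟩ := hrep y
  have ha : a.support.Nonempty := by
    rw [Finsupp.support_nonempty_iff]; rintro rfl; simp at hx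
  have hb : b.support.Nonempty := by
    rw [Finsupp.support_nonempty_iff]; rintro rfl; simp at hy
  -- In place of leading terms: some `m + n`, with `m`, `n` in the two supports, is not attained by
  -- any other pair of the supports. Its coefficient in the product applied to the empty monomial is
  -- then a single nonzero term.
  have : UniqueSums (Multiset ι) :=
    UniqueSums.of_injective_addHom (Multiset.toFinsupp (α := ι)).toAddMonoidHom.toAddHom
      Multiset.toFinsupp.injective inferInstance
  obtain ⟨m, hm, n, hn, hu⟩ := UniqueSums.uniqueAdd_of_nonempty ha hb
  intro h
  have key : monomialRep w hQ_diag hQ_inv ((a.sum fun m r => r • monomial w Q m) *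
      b.sum fun m r => r • monomial w Q m) (Finsupp.single 0 1) =
      ∑ i ∈ a.support, ∑ j ∈ b.support,
        Finsupp.single (i + j) (a i * (b j * (c j 0 * c i j))) := by
    simp only [Finsupp.sum, map_mul, map_sum, map_smul, Module.End.mul_apply, LinearMap.sum_apply,
      LinearMap.smul_apply, hc', Finsupp.smul_single, smul_eq_mul, add_zero,
      one_mul]
    simp only [mul_assoc]
    exact Finset.sum_comm
  rw [h, map_zero, LinearMap.zero_apply] at key
  have := DFunLike.congr_fun key (m + n)
  rw [Finsupp.finsetSum_apply, Finset.sum_eq_single m, Finsupp.finsetSum_apply,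
    Finset.sum_eq_single n, Finsupp.single_eq_same, Finsupp.zero_apply] at this
  · exact mul_ne_zero (Finsupp.mem_support_iff.1 hm) (mul_ne_zero (Finsupp.mem_support_iff.1 hn)
      (mul_ne_zero (c n 0).ne_zero (c m n).ne_zero)) this.symm
  · intro j hj hne
    rw [Finsupp.single_apply, if_neg]
    exact fun e => hne (hu hm hj e).2
  · exact fun h => absurd hn h
  · intro i hi hne
    rw [Finsupp.finsetSum_apply]
    refine Finset.sum_eq_zero fun j hj => ?_
    rw [Finsupp.single_apply, if_neg]
    exact fun e => hne (hu hi hj e).1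
  · exact fun h => absurd hm h

end Representation

/-! ### Setting generators to zero, and its compatibility with the smash product -/

section Projection

variable (w Q) in
open Classical in
/-- The algebra endomorphism that sends the generators with index in `s` to themselves and the
others to zero. -/
noncomputable def projection (s : Set ι) : QSym w Q →ₐ[k] QSym w Q :=
  lift (fun i => if i ∈ s then of w Q (w i) else 0) fun i j => by
    by_cases hi : i ∈ s <;> by_cases hj : j ∈ s <;> simp [hi, hj, of_mul_of w Q i j]

theorem projection_of_basis_of_notMem {s : Set ι} {i : ι} (hi : i ∉ s) :
    projection w Q s (of w Q (w i)) = 0 := by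
  rw [projection, lift_of_basis, if_neg hi]

theorem projection_of_mem_adjoin {s : Set ι} {x : QSym w Q}
    (hx : x ∈ Algebra.adjoin k ((fun i => of w Q (w i)) '' s)) : projection w Q s x = x := by
  have : Algebra.adjoin k ((fun i => of w Q (w i)) '' s) ≤
      AlgHom.equalizer (projection w Q s) (AlgHom.id k _) := by
    refine Algebra.adjoin_le ?_
    rintro _ ⟨i, hi, rfl⟩
    change projection w Q s (of w Q (w i)) = of w Q (w i)
    rw [projection, lift_of_basis, if_pos hi]
  exact this hx

end Projection

section Action

variable {G : Type*} [Group G] [DistribMulAction G V] [SMulCommClass G k V] [IsDiagonalAction G w]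

theorem smul_of_basis (g : G) (i : ι) : ∃ c : k, g • of w Q (w i) = c • of w Q (w i) := by
  obtain ⟨c, hc⟩ := IsDiagonalAction.exists_smul_eq (w := w) g i
  exact ⟨c, by rw [smul_of, hc, map_smul]⟩

theorem smul_mem_adjoin (g : G) {s : Set ι} {x : QSym w Q}
    (hx : x ∈ Algebra.adjoin k ((fun i => of w Q (w i)) '' s)) :
    g • x ∈ Algebra.adjoin k ((fun i => of w Q (w i)) '' s) := by
  have : Algebra.adjoin k ((fun i => of w Q (w i)) '' s) ≤
      (Algebra.adjoin k ((fun i => of w Q (w i)) '' s)).comap (actHom w Q g) := by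
    refine Algebra.adjoin_le ?_
    rintro _ ⟨i, hi, rfl⟩
    change g • of w Q (w i) ∈ Algebra.adjoin k ((fun i => of w Q (w i)) '' s)
    obtain ⟨c, hc⟩ := smul_of_basis (w := w) (Q := Q) g i
    rw [hc]
    exact Subalgebra.smul_mem _ (Algebra.subset_adjoin (Set.mem_image_of_mem _ hi)) c
  exact this hx

theorem projection_coeff_single_mul {s : Set ι} {i : ι} (hi : i ∉ s) (x : Smash w Q G) (g : G) :
    projection w Q s
      (((SkewMonoidAlgebra.single 1 (of w Q (w i)) : Smash w Q G) * x).coeff g) = 0 := by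
  rw [SkewMonoidAlgebra.coeff_single_one_mul, map_mul, projection_of_basis_of_notMem hi, zero_mul]

/-- Moving `w i` to the left of `g` replaces it by `g • w i`, still a multiple of `w i` because the
action is diagonal. -/
theorem projection_coeff_mul_single {s : Set ι} {i : ι} (hi : i ∉ s) (x : Smash w Q G) (g : G) :
    projection w Q s
      ((x * (SkewMonoidAlgebra.single 1 (of w Q (w i)) : Smash w Q G)).coeff g) = 0 := by
  obtain ⟨c, hc⟩ := smul_of_basis (w := w) (Q := Q) g i
  rw [SkewMonoidAlgebra.coeff_mul_single_one, hc, map_mul, map_smul,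
    projection_of_basis_of_notMem hi, smul_zero, mul_zero]

end Action

end QSym

/-! ### The obstruction to being a coboundary -/

section Obstruction

variable {k V ι G : Type*} [Field k] [AddCommGroup V] [Module k V] {w : Module.Basis ι k V}
  {Q : ι → ι → kˣ} [Group G] [DistribMulAction G V] [SMulCommClass G k V] [IsDiagonalAction G w]

/-- A Hochschild coboundary on the smash product, antisymmetrized on two generators, vanishes after
these generators are set to zero. -/
theorem projection_coeff_hochschildD1_sub (f : Smash w Q G →ₗ[k] Smash w Q G) {s : Set ι} {i j : ι}
    (hi : i ∉ s) (hj : j ∉ s) (g : G) :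
    QSym.projection w Q s ((hochschildD1 k (Smash w Q G) f
        (SkewMonoidAlgebra.single 1 (QSym.of w Q (w i)) ⊗ₜ
          SkewMonoidAlgebra.single 1 (QSym.of w Q (w j))) -
      (Q i j : k) • hochschildD1 k (Smash w Q G) f
        (SkewMonoidAlgebra.single 1 (QSym.of w Q (w j)) ⊗ₜ
          SkewMonoidAlgebra.single 1 (QSym.of w Q (w i)))).coeff g) = 0 := by
  have hcomm : (SkewMonoidAlgebra.single 1 (QSym.of w Q (w i)) : Smash w Q G) *
      SkewMonoidAlgebra.single 1 (QSym.of w Q (w j)) =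
      (Q i j : k) • (SkewMonoidAlgebra.single 1 (QSym.of w Q (w j)) *
        SkewMonoidAlgebra.single 1 (QSym.of w Q (w i))) := by
    rw [SkewMonoidAlgebra.single_mul_single, SkewMonoidAlgebra.single_mul_single, one_smul,
      one_smul, QSym.of_mul_of, SkewMonoidAlgebra.smul_single]
  -- The terms `f (w i * w j)` and `Q i j • f (w j * w i)` cancel. In the other four, `w i` or `w j`
  -- is a left or right factor.
  rw [hochschildD1_apply, hochschildD1_apply, hcomm, map_smul]
  simp only [smul_add, smul_sub, SkewMonoidAlgebra.coeff_sub, SkewMonoidAlgebra.coeff_add,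
    SkewMonoidAlgebra.coeff_smul, Finsupp.sub_apply, Finsupp.add_apply, Finsupp.smul_apply,
    map_sub, map_add, map_smul, QSym.projection_coeff_single_mul hi,
    QSym.projection_coeff_single_mul hj, QSym.projection_coeff_mul_single hi,
    QSym.projection_coeff_mul_single hj]
  simp

end Obstruction

end QuantumSmash

theorem mainTheorem1
    {k : Type*} [Field k] [CharZero k]
    -- the vector space `V` of dimension `r + 3 ≥ 3`; the basis vectors that are usually called
    -- `w₁, w₂, w₃, …` are `w 0, w 1, w 2, …`
    {V : Type*} [AddCommGroup V] [Module k V] {r : ℕ} (w : Module.Basis (Fin (r + 3)) k V)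
    (Q : Fin (r + 3) → Fin (r + 3) → kˣ) (hQ_diag : ∀ i, Q i i = 1)
    (hQ_inv : ∀ i j, Q j i = (Q i j)⁻¹)
    -- the finite group `G` with a diagonal linear action on `V`
    {G : Type*} [Group G] [Finite G] [DistribMulAction G V] [SMulCommClass G k V]
    [IsDiagonalAction G w]
    -- an `H_q`-module algebra structure on the smash product
    (q : kˣ) [Module (Hq q) (Smash w Q G)]
    [IsScalarTower k (Hq q) (Smash w Q G)]
    [IsModuleAlgebra k (Hq q) (Smash w Q G)]
    -- the prescribed action of `σ`
    (lam : Fin (r + 3) → kˣ) (ξ : G →* kˣ)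
    (hs_w : ∀ i, Hq.s q •
        (SkewMonoidAlgebra.single 1 (QSym.of w Q (w i)) : Smash w Q G) =
      (lam i : k) • SkewMonoidAlgebra.single 1 (QSym.of w Q (w i)))
    (hs_g : ∀ g : G, Hq.s q •
        (SkewMonoidAlgebra.single g 1 : Smash w Q G) =
      (ξ g : k) • SkewMonoidAlgebra.single g 1)
    -- the elements `P₁, P₂`
    (P₁ P₂ : QSym w Q) (hP₁ : P₁ ≠ 0) (hP₂ : P₂ ≠ 0)
    (hP₁_mem : P₁ ∈ Algebra.adjoin k
      ((fun i => QSym.of w Q (w i)) '' {i | i ≠ 0 ∧ i ≠ 1}))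
    (hP₂_mem : P₂ ∈ Algebra.adjoin k
      ((fun i => QSym.of w Q (w i)) '' {i | i ≠ 0 ∧ i ≠ 1}))
    (qP₁ qP₂ : Fin (r + 3) → k)
    (hP₁_comm : ∀ j, j ≠ 0 →
      P₁ * QSym.of w Q (w j) = qP₁ j • (QSym.of w Q (w j) * P₁))
    (hP₂_comm : ∀ j, j ≠ 1 →
      P₂ * QSym.of w Q (w j) = qP₂ j • (QSym.of w Q (w j) * P₂))
    -- the prescribed action of `D₁` and `D₂`
    (g₁ g₂ : G)
    (hD1_w : Hq.D1 q •
        (SkewMonoidAlgebra.single 1 (QSym.of w Q (w 0)) : Smash w Q G) =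
      SkewMonoidAlgebra.single g₁ P₁)
    (hD1_w_ne : ∀ i, i ≠ 0 → Hq.D1 q •
        (SkewMonoidAlgebra.single 1 (QSym.of w Q (w i)) : Smash w Q G) =
      0)
    (hD1_g : ∀ g : G, Hq.D1 q •
        (SkewMonoidAlgebra.single g 1 : Smash w Q G) = 0)
    (hD2_w : Hq.D2 q •
        (SkewMonoidAlgebra.single 1 (QSym.of w Q (w 1)) : Smash w Q G) =
      SkewMonoidAlgebra.single g₂ P₂)
    (hD2_w_ne : ∀ i, i ≠ 1 → Hq.D2 q •
        (SkewMonoidAlgebra.single 1 (QSym.of w Q (w i)) : Smash w Q G) =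
      0)
    (hD2_g : ∀ g : G, Hq.D2 q •
        (SkewMonoidAlgebra.single g 1 : Smash w Q G) = 0)
    -- the coefficients of the product `m ∘ exp_q (t D₁ ⊗ D₂)`
    (μ : ℕ → Smash w Q G ⊗[k] Smash w Q G →ₗ[k] Smash w Q G)
    (hμ : μ = twist (Hq.expq q)) :
    IsFormalDeformation μ ∧
      (∀ a b, μ 1 (a ⊗ₜ b) = (Hq.D1 q • a) * (Hq.D2 q • b)) ∧
      (∃ h : hochschildD2 k (Smash w Q G) (μ 1) = 0,
        HH2.mk (μ 1) h ≠ 0) ∧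
      ¬ IsTrivialDeformation μ := by
  subst hμ
  have hne : ¬∃ f, hochschildD1 k (Smash w Q G) f = twist (Hq.expq q) 1 := by
    rintro ⟨f, hf⟩
    have h0 : (0 : Fin (r + 3)) ∉ {i : Fin (r + 3) | i ≠ 0 ∧ i ≠ 1} := fun h => h.1 rfl
    have h1 : (1 : Fin (r + 3)) ∉ {i : Fin (r + 3) | i ≠ 0 ∧ i ≠ 1} := fun h => h.2 rfl
    have h10 : (1 : Fin (r + 3)) ≠ 0 := by simp
    -- The coefficient at `g₁ * g₂` is the one that carries `P₁ * g₁ • P₂`. The term with the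
    -- generators exchanged vanishes since `D₁` kills `w 1`.
    have key := projection_coeff_hochschildD1_sub f h0 h1 (g₁ * g₂)
    rw [hf, twist_expq_one, twist_expq_one, hD1_w, hD2_w, hD1_w_ne 1 h10, zero_mul, smul_zero,
      sub_zero, SkewMonoidAlgebra.single_mul_single, SkewMonoidAlgebra.coeff_single,
      Finsupp.single_eq_same, QSym.projection_of_mem_adjoin
        (mul_mem hP₁_mem (QSym.smul_mem_adjoin g₁ hP₂_mem))] at key
    exact QSym.mul_ne_zero_of_ne_zero hQ_diag hQ_inv hP₁ ((smul_ne_zero_iff_ne g₁).2 hP₂) key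
  exact ⟨isFormalDeformation_twist_expq, twist_expq_one,
    ⟨isAssocSeq_twist_expq.hochschildD2_eq_zero twist_expq_zero,
      fun h => hne ((HH2.mk_eq_zero _ _).1 h)⟩,
    fun h => hne (h.exists_hochschildD1_eq twist_expq_zero)⟩
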